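/- Let $H\in(0,\tfrac12)$, $\lambda>0$, $\sigma\in\mathbb{R}$, let $B^H=(B^H_t)_{t\in\mathbb{R}}$ be a two-sided fractional Brownian motion with Hurst parameter $H$ (a centred Gaussian process with almost surely continuous paths and $\mathbb{E}(B^H_sB^H_t)=\tfrac12(|s|^{2H}+|t|^{2H}-|t-s|^{2H})$), and let $$X_t=\sigma\int_{-\infty}^{t}e^{-\lambda(t-s)}\,dB^H_s,\qquad t\ge 0,$$ be the stationary fractional Ornstein–Uhlenbeck process, the integral being the pathwise (improper) Riemann–Stieltjes integral. Then each $X_t$ is square integrable. Write $R_X(s,t)=\mathbb{E}(X_sX_t)$ for its covariance and, for $\rho\ge1$ and $s<t$, put $$|R_X|^{\rho}_{\rho\text{-var};[s,t]^2}:=\sup\sum_{i,j}\Big|\mathbb{E}\big[(X_{t_{i+1}}-X_{t_i})(X_{t'_{j+1}}-X_{t'_j})\big]\Big|^{\rho},$$ the supremum being over all pairs of finite partitions $\{t_i\}$, $\{t'_j\}$ of $[s,t]$. There is a constant $C$ depending only on $H$, $\sigma$ and $\lambda$ such that for every $T>0$ the covariance $R_X$ is of finite $\frac1{2H}$-variation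 on $[0,T]^2$ in the 2D sense, i.e. $|R_X|_{\frac1{2H}\text{-var};[0,T]^2}<\infty$, and for all $s<t$ in $[0,T]$ $$|R_X|^{\frac1{2H}}_{\frac1{2H}\text{-var};[s,t]^2}\le C\,|t-s|.$$ -/

import Mathlib

open MeasureTheory ProbabilityTheory Filter Topology
open scoped ENNReal

/-- A (finite, strictly increasing) partition `a = t₀ < t₁ < ⋯ < tₙ = b` of the interval `[a, b]`. -/
structure IntervalPartition (a b : ℝ) where
  /-- the number of subintervals -/
  n : ℕ
  /-- the division points -/
  pt : Fin (n + 1) → ℝ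
  strictMono : StrictMono pt
  left : pt 0 = a
  right : pt (Fin.last n) = b

/-- `I` is the Riemann–Stieltjes integral `∫_a^b f dg`, as the limit of all tagged
Riemann–Stieltjes sums when the mesh of the partition tends to `0`. -/
def HasRSIntegral (f g : ℝ → ℝ) (a b I : ℝ) : Prop :=
  ∀ ε : ℝ, 0 < ε → ∃ δ : ℝ, 0 < δ ∧ ∀ (P : IntervalPartition a b) (ξ : Fin P.n → ℝ),
    (∀ i, ξ i ∈ Set.Icc (P.pt i.castSucc) (P.pt i.succ)) →
    (∀ i : Fin P.n, P.pt i.succ - P.pt i.castSucc < δ) →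
    |∑ i, f (ξ i) * (g (P.pt i.succ) - g (P.pt i.castSucc)) - I| < ε

/-- `I` is the improper Riemann–Stieltjes integral `∫_{-∞}^b f dg`. -/
def HasImproperRSIntegral (f g : ℝ → ℝ) (b I : ℝ) : Prop :=
  ∃ J : ℝ → ℝ, (∀ a, a < b → HasRSIntegral f g a b (J a)) ∧ Tendsto J atBot (𝓝 I)

/-- `B` is a (two-sided, one-dimensional) fractional Brownian motion with Hurst parameter `H`:
a centred Gaussian process indexed by `ℝ`, with almost surely continuous paths, and with
`E (B_s B_t) = (|s|^{2H} + |t|^{2H} - |t - s|^{2H}) / 2`. -/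
structure IsFractionalBrownianMotion {Ω : Type*} [MeasurableSpace Ω] (μ : Measure Ω) (H : ℝ)
    (B : ℝ → Ω → ℝ) : Prop where
  isGaussianProcess : IsGaussianProcess B μ
  mean_zero : ∀ t, ∫ ω, B t ω ∂μ = 0
  covariance_eq : ∀ s t, ∫ ω, B s ω * B t ω ∂μ =
    (|s| ^ (2 * H) + |t| ^ (2 * H) - |t - s| ^ (2 * H)) / 2
  continuous_paths : ∀ᵐ ω ∂μ, Continuous fun t => B t ω

/-- `X = (X_t)_{t ≥ 0}` is the stationary fractional Ornstein–Uhlenbeck process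
`X_t = σ ∫_{-∞}^t e^{-λ (t - s)} dB_s` driven by `B`, the integral being a pathwise one. -/
def IsStationaryFOU {Ω : Type*} [MeasurableSpace Ω] (μ : Measure Ω) (sigma lam : ℝ)
    (B X : ℝ → Ω → ℝ) : Prop :=
  ∀ t : ℝ, 0 ≤ t → ∀ᵐ ω ∂μ, ∃ I : ℝ,
    HasImproperRSIntegral (fun s => Real.exp (-lam * (t - s))) (fun s => B s ω) t I ∧
      X t ω = sigma * I

/-- The covariance `R_X(s, t) = E (X_s X_t)` of a (centred) process. -/
noncomputable def covFun {Ω : Type*} [MeasurableSpace Ω] (μ : Measure Ω) (X : ℝ → Ω → ℝ)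
    (s t : ℝ) : ℝ :=
  ∫ ω, X s ω * X t ω ∂μ

/-- The increment of `R` over the rectangle `[a, b] × [c, d]`. -/
def rectIncrement (R : ℝ → ℝ → ℝ) (a b c d : ℝ) : ℝ :=
  R b d - R a d - R b c + R a c

/-- The rectangular increment of the covariance `R_X` is `E ((X_b - X_a) (X_d - X_c))`. -/
theorem rectIncrement_covFun {Ω : Type*} [MeasurableSpace Ω] (μ : Measure Ω) (X : ℝ → Ω → ℝ)
    (a b c d : ℝ) (ha : MemLp (X a) 2 μ) (hb : MemLp (X b) 2 μ) (hc : MemLp (X c) 2 μ)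
    (hd : MemLp (X d) 2 μ) :
    rectIncrement (covFun μ X) a b c d = ∫ ω, (X b ω - X a ω) * (X d ω - X c ω) ∂μ := by
  have hbd : Integrable (fun ω => X b ω * X d ω) μ := hb.integrable_mul hd
  have had : Integrable (fun ω => X a ω * X d ω) μ := ha.integrable_mul hd
  have hbc : Integrable (fun ω => X b ω * X c ω) μ := hb.integrable_mul hc
  have hac : Integrable (fun ω => X a ω * X c ω) μ := ha.integrable_mul hc
  have h : (fun ω => (X b ω - X a ω) * (X d ω - X c ω)) = fun ω =>
      X b ω * X d ω - X a ω * X d ω - X b ω * X c ω + X a ω * X c ω := by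
    funext ω; ring
  have e1 := integral_add ((hbd.sub had).sub hbc) hac
  have e2 := integral_sub (hbd.sub had) hbc
  have e3 := integral_sub hbd had
  simp only [Pi.sub_apply] at e1 e2 e3
  rw [h, e1, e2, e3]
  rfl

/-- The 2D `ρ`-variation `|R|_{ρ-var; [a, b] × [c, d]}`, in `[0, ∞]`: the `ρ`-th root of the
supremum of `∑_{i,j} |R([t_i, t_{i+1}] × [t'_j, t'_{j+1}])|^ρ` over all partitions `(t_i)` of
`[a, b]` and `(t'_j)` of `[c, d]`. -/
noncomputable def pVariation2D (ρ : ℝ) (R : ℝ → ℝ → ℝ) (a b c d : ℝ) : ℝ≥0∞ :=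
  (⨆ (P : IntervalPartition a b) (Q : IntervalPartition c d),
    ∑ i : Fin P.n, ∑ j : Fin Q.n,
      ENNReal.ofReal (|rectIncrement R (P.pt i.castSucc) (P.pt i.succ)
        (Q.pt j.castSucc) (Q.pt j.succ)| ^ ρ)) ^ (1 / ρ)

/-! Fix `a ≤ b`. For fractional Brownian motion, `E[(B_b - B_a)(B_y - B_x)]` is half the increment
over `[x, y]` of `|x - a|^{2H} - |x - b|^{2H}`. As `2H < 1`, concavity makes this function fall,
rise and fall again, with total variation at most `4 (b - a)^{2H}`. So the covariances of one fixed
increment with those over any partition have absolute sum at most `2 (b - a)^{2H}`.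

This bound is shift invariant. An increment in `t` of a Riemann–Stieltjes sum for the
Ornstein–Uhlenbeck integral is `∑ c_k (D_{k+1} - D_k)`, with `D_k` a shifted increment of `B` and
`c_k` increasing in `[0, 1]`. Summation by parts (`sum_abs_sum_mul_sub_le`) costs a factor 2 in each
argument of the covariance, whatever the mesh and the cut-off. Hence the constant 8, and `8 σ²`
after scaling.

Almost sure limits of centred Gaussian variables preserve covariances
(`centered_gaussian_of_tendsto`), so the bound passes to `X`. With `ρ = 1/(2H) ≥ 1`, the `ℓ^ρ` norm
is at most the `ℓ¹` norm, so each strip contributes a multiple of its width, and the widths add up.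
-/

/-- The sum of the increments of a function over a partition telescopes. -/
theorem IntervalPartition.sum_sub {a b : ℝ} (P : IntervalPartition a b) (f : ℝ → ℝ) :
    ∑ i : Fin P.n, (f (P.pt i.succ) - f (P.pt i.castSucc)) = f b - f a := by
  have key : ∀ (n : ℕ) (p : Fin (n + 1) → ℝ),
      ∑ i : Fin n, (f (p i.succ) - f (p i.castSucc)) = f (p (Fin.last n)) - f (p 0) := by
    intro n
    induction n with
    | zero => intro p; simp
    | succ n ih =>
      intro p
      rw [Fin.sum_univ_castSucc]
      have := ih (fun i => p i.castSucc)
      simp only [← Fin.succ_castSucc, Fin.castSucc_zero] at this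
      rw [this]
      simp
  rw [key, P.left, P.right]

theorem IntervalPartition.le_succ {a b : ℝ} (P : IntervalPartition a b) (i : Fin P.n) :
    P.pt i.castSucc ≤ P.pt i.succ :=
  (P.strictMono i.castSucc_lt_succ).le

theorem IntervalPartition.left_le {a b : ℝ} (P : IntervalPartition a b) (i : Fin (P.n + 1)) :
    a ≤ P.pt i := by
  exact P.left.symm.trans_le (P.strictMono.monotone (Fin.zero_le i))

theorem IntervalPartition.sum_abs_sub_of_monotone {a b : ℝ} (P : IntervalPartition a b)
    {f : ℝ → ℝ} (hf : Monotone f) :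
    ∑ i : Fin P.n, |f (P.pt i.succ) - f (P.pt i.castSucc)| = f b - f a := by
  rw [← P.sum_sub f]
  exact Finset.sum_congr rfl fun i _ => abs_of_nonneg (sub_nonneg.2 (hf (P.le_succ i)))

theorem IntervalPartition.sum_abs_sub_of_antitone {a b : ℝ} (P : IntervalPartition a b)
    {f : ℝ → ℝ} (hf : Antitone f) :
    ∑ i : Fin P.n, |f (P.pt i.succ) - f (P.pt i.castSucc)| = f a - f b := by
  have h := P.sum_abs_sub_of_monotone (f := fun x => -f x) hf.neg
  rw [show f a - f b = -f b - -f a by ring, ← h]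
  refine Finset.sum_congr rfl fun i _ => ?_
  rw [← abs_neg]
  congr 1
  ring

/-! ### Total variation of differences of powers -/

/-- The increments of `y ↦ y ^ p`, `0 ≤ p ≤ 1`, over intervals of a fixed length decrease. -/
theorem antitoneOn_add_rpow_sub_rpow {p l : ℝ} (hp0 : 0 ≤ p) (hp1 : p ≤ 1) (hl : 0 ≤ l) :
    AntitoneOn (fun y : ℝ => (y + l) ^ p - y ^ p) (Set.Ici 0) := by
  intro x hx y hy hxy
  simp only [Set.mem_Ici] at hx hy
  rcases hl.eq_or_lt with rfl | hl
  · simp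
  have hc := (Real.concaveOn_rpow hp0 hp1).2
  -- `y` and `x + l` are convex combinations of `x` and `y + l` with the weights exchanged; adding
  -- the two concavity inequalities gives the claim.
  set d := y - x + l with hd
  have hdpos : 0 < d := by linarith
  have hsum : (y - x) / d + l / d = 1 := by rw [← add_div]; exact div_self hdpos.ne'
  have h1 := hc (x := x) hx (y := y + l) (by simp; linarith)
    (a := l / d) (b := (y - x) / d) (by positivity) (div_nonneg (by linarith) hdpos.le)
    (by linarith)
  have h2 := hc (x := x) hx (y := y + l) (by simp; linarith)
    (a := (y - x) / d) (b := l / d) (div_nonneg (by linarith) hdpos.le) (by positivity)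
    (by linarith)
  simp only [smul_eq_mul] at h1 h2
  have e1 : l / d * x + (y - x) / d * (y + l) = y := by field_simp; rw [hd]; ring
  have e2 : (y - x) / d * x + l / d * (y + l) = x + l := by field_simp; rw [hd]; ring
  rw [e1] at h1
  rw [e2] at h2
  have h3 : (y - x) / d = 1 - l / d := by linarith
  rw [h3] at h1 h2
  show (y + l) ^ p - y ^ p ≤ (x + l) ^ p - x ^ p
  linarith

/-- The function `x ↦ |x - a| ^ p - |x - b| ^ p`, `0 < p ≤ 1`, has total variation at most
`4 (b - a) ^ p`. -/
theorem IntervalPartition.sum_abs_rpow_sub_rpow_le {p a b c d : ℝ} (hp0 : 0 < p) (hp1 : p ≤ 1)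
    (hab : a ≤ b) (P : IntervalPartition c d) {f : ℝ → ℝ}
    (hf : ∀ x, f x = |x - a| ^ p - |x - b| ^ p) :
    ∑ i : Fin P.n, |f (P.pt i.succ) - f (P.pt i.castSucc)| ≤ 4 * (b - a) ^ p := by
  set l := b - a with hl
  have hl0 : 0 ≤ l := sub_nonneg.2 hab
  have hanti := antitoneOn_add_rpow_sub_rpow hp0.le hp1 hl0
  have hR : ∀ x, b ≤ x → f x = (x - b + l) ^ p - (x - b) ^ p := fun x hx => by
    rw [hf, abs_of_nonneg (by linarith), abs_of_nonneg (by linarith)]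
    congr 2; rw [hl]; ring
  have hL : ∀ x, x ≤ a → f x = -((a - x + l) ^ p - (a - x) ^ p) := fun x hx => by
    rw [hf, abs_of_nonpos (by linarith), abs_of_nonpos (by linarith), neg_sub, neg_sub]
    rw [show a - x + l = b - x by rw [hl]; ring]
    ring
  have hfb : f b = l ^ p := by rw [hR b le_rfl]; simp [Real.zero_rpow hp0.ne']
  have hfa : f a = -l ^ p := by rw [hL a le_rfl]; simp [Real.zero_rpow hp0.ne']
  have hlp : 0 ≤ l ^ p := Real.rpow_nonneg hl0 p
  have hM : MonotoneOn f (Set.Icc a b) := by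
    intro x hx y hy hxy
    have e : ∀ z ∈ Set.Icc a b, f z = (z - a) ^ p - (b - z) ^ p := fun z hz => by
      rw [hf, abs_of_nonneg (sub_nonneg.2 hz.1), abs_of_nonpos (sub_nonpos.2 hz.2), neg_sub]
    rw [e x hx, e y hy]
    have h1 : (x - a) ^ p ≤ (y - a) ^ p :=
      Real.rpow_le_rpow (sub_nonneg.2 hx.1) (by linarith) hp0.le
    have h2 : (b - y) ^ p ≤ (b - x) ^ p :=
      Real.rpow_le_rpow (sub_nonneg.2 hy.2) (by linarith) hp0.le
    linarith
  have hRa : AntitoneOn f (Set.Ici b) := fun x hx y hy hxy => by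
    rw [hR x hx, hR y hy]
    exact hanti (Set.mem_Ici.2 (sub_nonneg.2 hx)) (Set.mem_Ici.2 (sub_nonneg.2 hy)) (by linarith)
  have hLa : AntitoneOn f (Set.Iic a) := fun x hx y hy hxy => by
    rw [hL x hx, hL y hy, neg_le_neg_iff]
    exact hanti (Set.mem_Ici.2 (sub_nonneg.2 hy)) (Set.mem_Ici.2 (sub_nonneg.2 hx)) (by linarith)
  have hRn : ∀ x, b ≤ x → 0 ≤ f x := fun x hx => by
    rw [hR x hx, sub_nonneg]
    exact Real.rpow_le_rpow (sub_nonneg.2 hx) (by linarith) hp0.le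
  have hLn : ∀ x, x ≤ a → f x ≤ 0 := fun x hx => by
    rw [hL x hx, neg_nonpos, sub_nonneg]
    exact Real.rpow_le_rpow (sub_nonneg.2 hx) (by linarith) hp0.le
  -- Clamping to `[a, b]` splits `f = u + v`: `u` carries the rise on `[a, b]`, `v` the two outer
  -- descents. Both are monotone with values in `[-l ^ p, l ^ p]`, so each varies by at most `2 * l
  -- ^ p`.
  let k : ℝ → ℝ := fun x => max a (min x b)
  have hk : Monotone k := fun x y hxy => max_le_max_left _ (min_le_min_right _ hxy)
  have hkI : ∀ x, k x ∈ Set.Icc a b := fun x =>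
    ⟨le_max_left _ _, max_le hab (min_le_right _ _)⟩
  have hkL : ∀ x, x ≤ a → k x = a := fun x hx => by
    simp only [k]; rw [min_eq_left (hx.trans hab), max_eq_left hx]
  have hkM : ∀ x, a ≤ x → x ≤ b → k x = x := fun x h1 h2 => by
    simp only [k]; rw [min_eq_left h2, max_eq_right h1]
  have hkR : ∀ x, b ≤ x → k x = b := fun x hx => by
    simp only [k]; rw [min_eq_right hx, max_eq_right hab]
  let u : ℝ → ℝ := fun x => f (k x)
  let v : ℝ → ℝ := fun x => f x - f (k x)
  have hu : Monotone u := fun x y hxy => hM (hkI x) (hkI y) (hk hxy)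
  have hvL : ∀ x, x ≤ a → v x = f x + l ^ p := fun x hx => by
    simp only [v]; rw [hkL x hx, hfa]; ring
  have hvM : ∀ x, a ≤ x → x ≤ b → v x = 0 := fun x h1 h2 => by
    simp only [v]; rw [hkM x h1 h2]; ring
  have hvR : ∀ x, b ≤ x → v x = f x - l ^ p := fun x hx => by
    simp only [v]; rw [hkR x hx, hfb]
  have hv1 : AntitoneOn v (Set.Iic a) := fun x hx y hy hxy => by
    rw [hvL x hx, hvL y hy]; linarith [hLa hx hy hxy]
  have hv2 : AntitoneOn v (Set.Icc a b) := fun x hx y hy _ => by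
    rw [hvM x hx.1 hx.2, hvM y hy.1 hy.2]
  have hv3 : AntitoneOn v (Set.Ici b) := fun x hx y hy hxy => by
    rw [hvR x hx, hvR y hy]; linarith [hRa hx hy hxy]
  have hv : Antitone v := by
    have h12 : AntitoneOn v (Set.Iic b) := by
      rw [← Set.Iic_union_Icc_eq_Iic hab]
      exact hv1.union_right hv2 isGreatest_Iic (isLeast_Icc hab)
    exact h12.Iic_union_Ici hv3
  have hub : ∀ x, -l ^ p ≤ u x ∧ u x ≤ l ^ p := fun x => by
    rw [← hfa, ← hfb]
    exact ⟨hM ⟨le_rfl, hab⟩ (hkI x) (hkI x).1, hM (hkI x) ⟨hab, le_rfl⟩ (hkI x).2⟩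
  have hvb : ∀ x, -l ^ p ≤ v x ∧ v x ≤ l ^ p := fun x => by
    constructor
    · calc -l ^ p ≤ v (max x b) := by
            rw [hvR _ (le_max_right _ _)]; linarith [hRn (max x b) (le_max_right _ _)]
        _ ≤ v x := hv (le_max_left _ _)
    · calc v x ≤ v (min x a) := hv (min_le_left _ _)
        _ ≤ l ^ p := by
            rw [hvL _ (min_le_right _ _)]; linarith [hLn (min x a) (min_le_right _ _)]
  calc ∑ i : Fin P.n, |f (P.pt i.succ) - f (P.pt i.castSucc)|
      ≤ ∑ i : Fin P.n, (|u (P.pt i.succ) - u (P.pt i.castSucc)| +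
          |v (P.pt i.succ) - v (P.pt i.castSucc)|) := by
        refine Finset.sum_le_sum fun i _ => ?_
        refine le_trans (le_of_eq ?_) (abs_add_le _ _)
        congr 1
        simp only [u, v]
        ring
    _ = (u d - u c) + (v c - v d) := by
        rw [Finset.sum_add_distrib, P.sum_abs_sub_of_monotone hu, P.sum_abs_sub_of_antitone hv]
    _ ≤ 4 * l ^ p := by linarith [(hub c).1, (hub d).2, (hvb c).2, (hvb d).1]

/-! ### Summation by parts and passage from `ℓ¹` to `ℓ^ρ` -/

/-- Summation by parts. -/
theorem sum_range_mul_sub (c β : ℕ → ℝ) (n : ℕ) :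
    ∑ k ∈ Finset.range n, c k * (β (k + 1) - β k) =
      c n * β n - c 0 * β 0 - ∑ k ∈ Finset.range n, (c (k + 1) - c k) * β (k + 1) := by
  induction n with
  | zero => simp
  | succ n ih => rw [Finset.sum_range_succ, Finset.sum_range_succ, ih]; ring

/-- The `ℓ¹` norm of `∑ k, c k • (β (k + 1) - β k)` for increasing weights `c k` in `[0, 1]` is at
most twice the largest `ℓ¹` norm of the vectors `β k`. -/
theorem sum_abs_sum_mul_sub_le {ι : Type*} [Fintype ι] {c : ℕ → ℝ} (hc : Monotone c)
    (hc0 : 0 ≤ c 0) {n : ℕ} (hc1 : c n ≤ 1) {β : ℕ → ι → ℝ} {K : ℝ}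
    (hβ : ∀ k, ∑ j, |β k j| ≤ K) :
    ∑ j, |∑ k ∈ Finset.range n, c k * (β (k + 1) j - β k j)| ≤ 2 * K := by
  have hcn : 0 ≤ c n := hc0.trans (hc (Nat.zero_le n))
  have hK : 0 ≤ K := (Finset.sum_nonneg fun j _ => abs_nonneg (β 0 j)).trans (hβ 0)
  calc ∑ j, |∑ k ∈ Finset.range n, c k * (β (k + 1) j - β k j)|
      ≤ ∑ j, (c n * |β n j| + c 0 * |β 0 j| +
          ∑ k ∈ Finset.range n, (c (k + 1) - c k) * |β (k + 1) j|) := by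
        refine Finset.sum_le_sum fun j _ => ?_
        rw [sum_range_mul_sub c (fun k => β k j) n]
        refine (abs_sub _ _).trans (add_le_add ((abs_sub _ _).trans ?_) ?_)
        · rw [abs_mul, abs_mul, abs_of_nonneg hcn, abs_of_nonneg hc0]
        · refine (Finset.abs_sum_le_sum_abs _ _).trans (Finset.sum_le_sum fun k _ => ?_)
          rw [abs_mul, abs_of_nonneg (sub_nonneg.2 (hc k.le_succ))]
    _ = c n * ∑ j, |β n j| + c 0 * ∑ j, |β 0 j| +
          ∑ k ∈ Finset.range n, (c (k + 1) - c k) * ∑ j, |β (k + 1) j| := by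
        simp only [Finset.sum_add_distrib, Finset.mul_sum]
        rw [Finset.sum_comm]
    _ ≤ c n * K + c 0 * K + ∑ k ∈ Finset.range n, (c (k + 1) - c k) * K := by
        gcongr with k _
        · exact hβ n
        · exact hβ 0
        · exact sub_nonneg.2 (hc k.le_succ)
        · exact hβ (k + 1)
    _ = 2 * (c n * K) := by rw [← Finset.sum_mul, Finset.sum_range_sub]; ring
    _ ≤ 2 * K := by nlinarith

theorem sum_rpow_le_rpow_sum {ι : Type*} (s : Finset ι) {x : ι → ℝ} (hx : ∀ i, 0 ≤ x i) {p : ℝ}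
    (hp : 1 ≤ p) : ∑ i ∈ s, x i ^ p ≤ (∑ i ∈ s, x i) ^ p := by
  classical
  induction s using Finset.induction_on with
  | empty => simp [Real.zero_rpow (by linarith : p ≠ 0)]
  | insert i s hi ih =>
    rw [Finset.sum_insert hi, Finset.sum_insert hi]
    exact (by gcongr : _ ≤ x i ^ p + (∑ i ∈ s, x i) ^ p).trans
      (Real.add_rpow_le_rpow_add (hx i) (Finset.sum_nonneg fun i _ => hx i) hp)

/-- A function whose rectangular increments over each strip `[a, b] × [s, t]` have sum at most
`K (b - a) ^ (1 / ρ)` has 2D `ρ`-variation to the power `ρ` at most `K ^ ρ (t - s)`. -/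
theorem iSup_sum_rpow_rectIncrement_le {R : ℝ → ℝ → ℝ} {s t ρ K : ℝ} (hρ : 1 ≤ ρ) (hK : 0 ≤ K)
    (hR : ∀ a b, s ≤ a → a ≤ b → ∀ Q : IntervalPartition s t,
      ∑ j : Fin Q.n, |rectIncrement R a b (Q.pt j.castSucc) (Q.pt j.succ)| ≤
        K * (b - a) ^ (1 / ρ)) :
    ⨆ (P : IntervalPartition s t) (Q : IntervalPartition s t),
      ∑ i : Fin P.n, ∑ j : Fin Q.n,
        ENNReal.ofReal (|rectIncrement R (P.pt i.castSucc) (P.pt i.succ)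
          (Q.pt j.castSucc) (Q.pt j.succ)| ^ ρ) ≤ ENNReal.ofReal (K ^ ρ * (t - s)) := by
  have hρ0 : 0 < ρ := by linarith
  refine iSup_le fun P => iSup_le fun Q => ?_
  have hnn : ∀ x : ℝ, 0 ≤ |x| ^ ρ := fun x => Real.rpow_nonneg (abs_nonneg x) ρ
  simp_rw [← ENNReal.ofReal_sum_of_nonneg fun _ _ => hnn _]
  rw [← ENNReal.ofReal_sum_of_nonneg fun _ _ => Finset.sum_nonneg fun _ _ => hnn _]
  refine ENNReal.ofReal_le_ofReal ?_
  -- Writing `t - s` as the sum of the strip widths reduces the claim to one strip at a time.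
  rw [← P.sum_sub fun x => x, Finset.mul_sum]
  refine Finset.sum_le_sum fun i _ => ?_
  have hl : 0 ≤ P.pt i.succ - P.pt i.castSucc := sub_nonneg.2 (P.le_succ i)
  calc _ ≤ (∑ j : Fin Q.n, |rectIncrement R (P.pt i.castSucc) (P.pt i.succ)
          (Q.pt j.castSucc) (Q.pt j.succ)|) ^ ρ :=
        sum_rpow_le_rpow_sum _ (fun _ => abs_nonneg _) hρ
    _ ≤ (K * (P.pt i.succ - P.pt i.castSucc) ^ (1 / ρ)) ^ ρ := by
        gcongr
        exact hR _ _ (P.left_le _) (P.le_succ i) Q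
    _ = K ^ ρ * (P.pt i.succ - P.pt i.castSucc) := by
        rw [Real.mul_rpow hK (Real.rpow_nonneg hl _), ← Real.rpow_mul hl,
          one_div_mul_cancel hρ0.ne', Real.rpow_one]

/-! ### Centred Gaussian spaces and their almost sure limits -/

/-- A linear space of random variables with centred Gaussian laws. -/
def IsCenteredGaussianSpace {Ω : Type*} [MeasurableSpace Ω] (μ : Measure Ω)
    (G : Submodule ℝ (Ω → ℝ)) : Prop :=
  ∀ Z ∈ G, HasGaussianLaw Z μ ∧ ∫ ω, Z ω ∂μ = 0

theorem charFun_map_of_centered_gaussian {Ω : Type*} [MeasurableSpace Ω] {μ : Measure Ω}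
    {Z : Ω → ℝ} (hZ : HasGaussianLaw Z μ) (h0 : ∫ ω, Z ω ∂μ = 0) (ξ : ℝ) :
    charFun (μ.map Z) ξ = (Real.exp (-(ξ ^ 2 / 2) * ∫ ω, Z ω ^ 2 ∂μ) : ℂ) := by
  have hv : Var[Z; μ] = ∫ ω, Z ω ^ 2 ∂μ := variance_of_integral_eq_zero hZ.aemeasurable h0
  have hn : 0 ≤ ∫ ω, Z ω ^ 2 ∂μ := integral_nonneg fun ω => sq_nonneg _
  rw [hZ.map_eq_gaussianReal, charFun_gaussianReal, h0, hv, Real.coe_toNNReal _ hn]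
  push_cast
  congr 1
  ring

/-- An almost sure limit of centred Gaussian variables is centred Gaussian, and the variances
converge. -/
theorem centered_gaussian_of_tendsto {Ω : Type*} [MeasurableSpace Ω] {μ : Measure Ω}
    [IsProbabilityMeasure μ] {z : ℕ → Ω → ℝ} {Z : Ω → ℝ} (hz : ∀ n, HasGaussianLaw (z n) μ)
    (h0 : ∀ n, ∫ ω, z n ω ∂μ = 0) (hlim : ∀ᵐ ω ∂μ, Tendsto (fun n => z n ω) atTop (𝓝 (Z ω))) :
    (HasGaussianLaw Z μ ∧ ∫ ω, Z ω ∂μ = 0) ∧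
      Tendsto (fun n => ∫ ω, z n ω ^ 2 ∂μ) atTop (𝓝 (∫ ω, Z ω ^ 2 ∂μ)) := by
  have hZm : AEMeasurable Z μ := aemeasurable_of_tendsto_metrizable_ae atTop
    (fun n => (hz n).aemeasurable) hlim
  have : IsProbabilityMeasure (μ.map Z) := Measure.isProbabilityMeasure_map hZm
  have hcf : ∀ ξ : ℝ, Tendsto (fun n => charFun (μ.map (z n)) ξ) atTop
      (𝓝 (charFun (μ.map Z) ξ)) := by
    intro ξ
    have e : ∀ Y : Ω → ℝ, AEMeasurable Y μ → charFun (μ.map Y) ξ =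
        ∫ ω, Complex.exp (ξ * Y ω * Complex.I) ∂μ := fun Y hY => by
      rw [charFun_apply_real, integral_map hY (by fun_prop)]
    rw [e Z hZm]
    simp_rw [fun n => e (z n) (hz n).aemeasurable]
    refine tendsto_integral_of_dominated_convergence (fun _ => 1) (fun n => ?_)
      (integrable_const _) (fun n => ?_) ?_
    · have := (hz n).aemeasurable
      exact AEMeasurable.aestronglyMeasurable (by fun_prop)
    · refine Eventually.of_forall fun ω => le_of_eq ?_
      rw [← Complex.ofReal_mul, Complex.norm_exp_ofReal_mul_I]
    · filter_upwards [hlim] with ω hω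
      have hc : Continuous fun x : ℝ => Complex.exp (ξ * x * Complex.I) := by fun_prop
      exact (hc.tendsto _).comp hω
  have hre : ∀ ξ : ℝ, Tendsto (fun n => Real.exp (-(ξ ^ 2 / 2) * ∫ ω, z n ω ^ 2 ∂μ)) atTop
      (𝓝 (charFun (μ.map Z) ξ).re) := by
    intro ξ
    have h := (Complex.continuous_re.tendsto _).comp (hcf ξ)
    refine h.congr fun n => ?_
    simp only [Function.comp_apply]
    rw [charFun_map_of_centered_gaussian (hz n) (h0 n), Complex.ofReal_re]
  have him : ∀ ξ : ℝ, (charFun (μ.map Z) ξ).im = 0 := by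
    intro ξ
    have h := (Complex.continuous_im.tendsto _).comp (hcf ξ)
    refine tendsto_nhds_unique (h.congr fun n => ?_) tendsto_const_nhds
    simp only [Function.comp_apply]
    rw [charFun_map_of_centered_gaussian (hz n) (h0 n), Complex.ofReal_im]
  -- The limit characteristic function is continuous and equals 1 at 0, so it is positive at some `ξ
  -- ≠ 0`. A logarithm there yields convergence of the variances, with no prior bound on them.
  obtain ⟨ξ, hξ0, hξ⟩ : ∃ ξ : ℝ, ξ ≠ 0 ∧ 0 < (charFun (μ.map Z) ξ).re := by
    have hcont : Continuous fun ξ : ℝ => (charFun (μ.map Z) ξ).re :=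
      Complex.continuous_re.comp continuous_charFun
    have h1 : ∀ᶠ ξ in 𝓝 (0 : ℝ), 0 < (charFun (μ.map Z) ξ).re :=
      hcont.continuousAt.eventually_const_lt (by simp)
    have h2 : ∀ᶠ ξ in 𝓝[≠] (0 : ℝ), 0 < (charFun (μ.map Z) ξ).re := h1.filter_mono inf_le_left
    obtain ⟨ξ, h, h'⟩ := (h2.and self_mem_nhdsWithin).exists
    exact ⟨ξ, h', h⟩
  obtain ⟨v, hv⟩ : ∃ v, Tendsto (fun n => ∫ ω, z n ω ^ 2 ∂μ) atTop (𝓝 v) := by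
    refine ⟨-(2 / ξ ^ 2) * Real.log (charFun (μ.map Z) ξ).re, ?_⟩
    have h := ((hre ξ).log hξ.ne').const_mul (-(2 / ξ ^ 2))
    refine h.congr fun n => ?_
    rw [Real.log_exp]
    field_simp
  have hv0 : 0 ≤ v := ge_of_tendsto' hv fun n => integral_nonneg fun ω => sq_nonneg _
  have hmap : μ.map Z = gaussianReal 0 v.toNNReal := by
    refine Measure.ext_of_charFun ?_
    funext ξ
    rw [charFun_gaussianReal, Real.coe_toNNReal _ hv0]
    have h1 : (charFun (μ.map Z) ξ).re = Real.exp (-(ξ ^ 2 / 2) * v) :=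
      tendsto_nhds_unique (hre ξ) ((Real.continuous_exp.tendsto _).comp (hv.const_mul _))
    have h2 : charFun (μ.map Z) ξ = (Real.exp (-(ξ ^ 2 / 2) * v) : ℂ) := by
      rw [← h1]
      apply Complex.ext
      · simp
      · simp [him ξ]
    rw [h2]
    push_cast
    congr 1
    ring
  have hG : HasGaussianLaw Z μ := ⟨by rw [hmap]; infer_instance⟩
  have hmean : ∫ ω, Z ω ∂μ = 0 := by
    have h : ∫ x, x ∂(μ.map Z) = ∫ ω, Z ω ∂μ :=
      integral_map hZm measurable_id.aestronglyMeasurable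
    rw [← h, hmap, integral_id_gaussianReal]
  refine ⟨⟨hG, hmean⟩, ?_⟩
  have hvar : ∫ ω, Z ω ^ 2 ∂μ = v := by
    rw [← variance_of_integral_eq_zero hZm hmean, ← variance_id_map hZm, hmap,
      variance_id_gaussianReal, Real.coe_toNNReal _ hv0]
  rwa [hvar]

/-- The almost sure limits of sequences in a linear space of random variables. -/
def aeLimits {Ω : Type*} [MeasurableSpace Ω] (μ : Measure Ω) (G : Submodule ℝ (Ω → ℝ)) :
    Submodule ℝ (Ω → ℝ) where
  carrier := {Z | ∃ z : ℕ → Ω → ℝ, (∀ n, z n ∈ G) ∧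
    ∀ᵐ ω ∂μ, Tendsto (fun n => z n ω) atTop (𝓝 (Z ω))}
  zero_mem' := ⟨fun _ => 0, fun _ => G.zero_mem, Eventually.of_forall fun _ => tendsto_const_nhds⟩
  add_mem' := by
    rintro Y Z ⟨y, hy, hyl⟩ ⟨z, hz, hzl⟩
    refine ⟨fun n => y n + z n, fun n => G.add_mem (hy n) (hz n), ?_⟩
    filter_upwards [hyl, hzl] with ω h1 h2 using h1.add h2
  smul_mem' := by
    rintro c Z ⟨z, hz, hzl⟩
    refine ⟨fun n => c • z n, fun n => G.smul_mem c (hz n), ?_⟩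
    filter_upwards [hzl] with ω h using h.const_mul c

section

variable {Ω : Type*} [MeasurableSpace Ω] {μ : Measure Ω} {G : Submodule ℝ (Ω → ℝ)}

theorem IsCenteredGaussianSpace.aeLimits [IsProbabilityMeasure μ]
    (hG : IsCenteredGaussianSpace μ G) : IsCenteredGaussianSpace μ (aeLimits μ G) := by
  rintro Z ⟨z, hz, hzl⟩
  exact (centered_gaussian_of_tendsto (fun n => (hG _ (hz n)).1) (fun n => (hG _ (hz n)).2) hzl).1

theorem IsCenteredGaussianSpace.memLp_two (hG : IsCenteredGaussianSpace μ G) {Z : Ω → ℝ}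
    (hZ : Z ∈ G) : MemLp Z 2 μ :=
  (hG Z hZ).1.memLp_two

theorem IsCenteredGaussianSpace.integrable_mul (hG : IsCenteredGaussianSpace μ G) {Y Z : Ω → ℝ}
    (hY : Y ∈ G) (hZ : Z ∈ G) : Integrable (fun ω => Y ω * Z ω) μ :=
  (hG.memLp_two hY).integrable_mul (hG.memLp_two hZ)

/-- Covariances converge along almost surely convergent sequences of a centred Gaussian space. -/
theorem IsCenteredGaussianSpace.tendsto_integral_mul [IsProbabilityMeasure μ]
    (hG : IsCenteredGaussianSpace μ G) {y z : ℕ → Ω → ℝ} {Y Z : Ω → ℝ} (hy : ∀ n, y n ∈ G)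
    (hz : ∀ n, z n ∈ G) (hyl : ∀ᵐ ω ∂μ, Tendsto (fun n => y n ω) atTop (𝓝 (Y ω)))
    (hzl : ∀ᵐ ω ∂μ, Tendsto (fun n => z n ω) atTop (𝓝 (Z ω))) :
    Tendsto (fun n => ∫ ω, y n ω * z n ω ∂μ) atTop (𝓝 (∫ ω, Y ω * Z ω ∂μ)) := by
  -- Polarization reduces covariances to second moments; it is needed both in `G` and in `aeLimits μ
  -- G`.
  have polar : ∀ {G' : Submodule ℝ (Ω → ℝ)}, IsCenteredGaussianSpace μ G' → ∀ {U V : Ω → ℝ},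
      U ∈ G' → V ∈ G' → ∫ ω, U ω * V ω ∂μ =
        (∫ ω, (U + V) ω ^ 2 ∂μ - ∫ ω, (U - V) ω ^ 2 ∂μ) / 4 := by
    intro G' hG' U V hU hV
    rw [← integral_sub (hG'.memLp_two (G'.add_mem hU hV)).integrable_sq
      (hG'.memLp_two (G'.sub_mem hU hV)).integrable_sq, ← integral_div]
    congr 1
    funext ω
    simp only [Pi.add_apply, Pi.sub_apply]
    ring
  have sq : ∀ {u : ℕ → Ω → ℝ} {U : Ω → ℝ}, (∀ n, u n ∈ G) →
      (∀ᵐ ω ∂μ, Tendsto (fun n => u n ω) atTop (𝓝 (U ω))) →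
      Tendsto (fun n => ∫ ω, u n ω ^ 2 ∂μ) atTop (𝓝 (∫ ω, U ω ^ 2 ∂μ)) := fun hu hul =>
    (centered_gaussian_of_tendsto (fun n => (hG _ (hu n)).1) (fun n => (hG _ (hu n)).2) hul).2
  rw [polar hG.aeLimits ⟨y, hy, hyl⟩ ⟨z, hz, hzl⟩]
  simp_rw [fun n => polar hG (hy n) (hz n)]
  refine ((sq (fun n => G.add_mem (hy n) (hz n)) ?_).sub
    (sq (fun n => G.sub_mem (hy n) (hz n)) ?_)).div_const 4
  · filter_upwards [hyl, hzl] with ω h1 h2 using h1.add h2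
  · filter_upwards [hyl, hzl] with ω h1 h2 using h1.sub h2

theorem IsCenteredGaussianSpace.integral_mul_sum (hG : IsCenteredGaussianSpace μ G)
    {Y : Ω → ℝ} (hY : Y ∈ G) {Z : ℕ → Ω → ℝ} (hZ : ∀ k, Z k ∈ G) (c : ℕ → ℝ) (n : ℕ) :
    ∫ ω, Y ω * (∑ k ∈ Finset.range n, c k * Z k ω) ∂μ =
      ∑ k ∈ Finset.range n, c k * ∫ ω, Y ω * Z k ω ∂μ := by
  simp_rw [Finset.mul_sum, mul_left_comm (Y _)]
  rw [integral_finsetSum _ fun k _ => (hG.integrable_mul hY (hZ k)).const_mul (c k)]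
  simp_rw [integral_const_mul]

/-- The linear span of a centred Gaussian process is a centred Gaussian space. -/
theorem IsGaussianProcess.isCenteredGaussianSpace_span {T : Type*} {B : T → Ω → ℝ}
    (hB : IsGaussianProcess B μ) (h0 : ∀ t, ∫ ω, B t ω ∂μ = 0) :
    IsCenteredGaussianSpace μ (Submodule.span ℝ (Set.range B)) := by
  intro Z hZ
  obtain ⟨c, rfl⟩ := (Finsupp.mem_span_range_iff_exists_finsupp).1 hZ
  have e : (c.sum fun t a => a • B t) = ∑ t ∈ c.support, fun ω => c t • B t ω := by
    rw [Finsupp.sum]; rfl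
  rw [e]
  have hs := hB.smul (fun t => c t)
  refine ⟨hs.hasGaussianLaw_sum, ?_⟩
  simp only [Finset.sum_apply]
  rw [integral_finsetSum _ fun t _ => (hs.hasGaussianLaw_eval t).integrable]
  simp [integral_const_mul, h0]

end

/-! ### Riemann–Stieltjes sums on equal divisions -/

/-- The distances to the right end point of the division points of an interval of length `M` into
`n + 1` equal parts. -/
noncomputable def equiLag (M : ℝ) (n k : ℕ) : ℝ :=
  M * (1 - k / (n + 1))

theorem equiLag_succ (M : ℝ) (n k : ℕ) : equiLag M n (k + 1) = equiLag M n k - M / (n + 1) := by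
  have : (n + 1 : ℝ) ≠ 0 := by positivity
  unfold equiLag
  push_cast
  field_simp
  ring

theorem equiLag_zero (M : ℝ) (n : ℕ) : equiLag M n 0 = M := by simp [equiLag]

theorem equiLag_last (M : ℝ) (n : ℕ) : equiLag M n (n + 1) = 0 := by
  have : (n + 1 : ℝ) ≠ 0 := by positivity
  simp [equiLag, this]

theorem equiLag_strictAnti {M : ℝ} (hM : 0 < M) (n : ℕ) : StrictAnti (equiLag M n) :=
  strictAnti_nat_of_succ_lt fun k => by
    rw [equiLag_succ]
    have : 0 < M / (n + 1) := by positivity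
    linarith

/-- The division of `[t - M, t]` into `n + 1` equal parts. -/
noncomputable def equiPartition (t : ℝ) {M : ℝ} (hM : 0 < M) (n : ℕ) :
    IntervalPartition (t - M) t where
  n := n + 1
  pt k := t - equiLag M n k
  strictMono i j hij := by
    have := equiLag_strictAnti hM n (show (i : ℕ) < j from hij)
    show t - _ < t - _
    linarith
  left := by simp [equiLag_zero]
  right := by simp [equiLag_last]

/-- The Riemann–Stieltjes sum of `∫_{t-M}^t e^{-λ (t - s)} dg(s)` over the division of `[t - M, t]`
into `n + 1` equal parts, with the left end points as tags. -/
noncomputable def expRSSum (lam : ℝ) (g : ℝ → ℝ) (M : ℝ) (n : ℕ) (t : ℝ) : ℝ :=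
  ∑ k ∈ Finset.range (n + 1), Real.exp (-lam * equiLag M n k) *
    (g (t - equiLag M n (k + 1)) - g (t - equiLag M n k))

theorem HasRSIntegral.tendsto_expRSSum {lam : ℝ} {g : ℝ → ℝ} {M t I : ℝ} (hM : 0 < M)
    (h : HasRSIntegral (fun s => Real.exp (-lam * (t - s))) g (t - M) t I) :
    Tendsto (fun n => expRSSum lam g M n t) atTop (𝓝 I) := by
  rw [Metric.tendsto_atTop]
  intro ε hε
  obtain ⟨δ, hδ, hP⟩ := h ε hε
  obtain ⟨N, hN⟩ := exists_nat_gt (M / δ)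
  refine ⟨N, fun n hn => ?_⟩
  have hmesh : M / (n + 1) < δ := by
    rw [div_lt_iff₀ (by positivity)]
    rw [div_lt_iff₀ hδ] at hN
    have : (N : ℝ) ≤ n := by exact_mod_cast hn
    nlinarith
  have h1 := hP (equiPartition t hM n) (fun i => (equiPartition t hM n).pt i.castSucc)
    (fun i => ⟨le_rfl, (equiPartition t hM n).le_succ i⟩) (fun i => by
      show (t - equiLag M n ((i : ℕ) + 1)) - (t - equiLag M n i) < δ
      rw [equiLag_succ]
      linarith)
  rw [Real.dist_eq]
  convert h1 using 3
  rw [expRSSum, ← Fin.sum_univ_eq_sum_range (fun k => Real.exp (-lam * equiLag M n k) *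
    (g (t - equiLag M n (k + 1)) - g (t - equiLag M n k)))]
  refine Finset.sum_congr rfl fun i _ => ?_
  show _ = Real.exp (-lam * (t - (t - equiLag M n i))) *
    (g (t - equiLag M n ((i : ℕ) + 1)) - g (t - equiLag M n i))
  rw [sub_sub_cancel]

theorem expRSSum_mem {Ω : Type*} {G : Submodule ℝ (Ω → ℝ)} {B : ℝ → Ω → ℝ}
    (hB : ∀ t, B t ∈ G) (lam M : ℝ) (n : ℕ) (t : ℝ) :
    (fun ω => expRSSum lam (fun s => B s ω) M n t) ∈ G := by
  have e : (fun ω => expRSSum lam (fun s => B s ω) M n t) =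
      ∑ k ∈ Finset.range (n + 1), Real.exp (-lam * equiLag M n k) •
        (B (t - equiLag M n (k + 1)) - B (t - equiLag M n k)) := by
    funext ω
    simp [expRSSum]
  rw [e]
  exact G.sum_mem fun k _ => G.smul_mem _ (G.sub_mem (hB _) (hB _))

/-- The lags and weights do not depend on `t`, so the increment can be regrouped into consecutive
differences of shifted increments of `g`, ready for summation by parts. -/
theorem expRSSum_sub (lam : ℝ) (g : ℝ → ℝ) (M : ℝ) (n : ℕ) (u v : ℝ) :
    expRSSum lam g M n v - expRSSum lam g M n u =
      ∑ k ∈ Finset.range (n + 1), Real.exp (-lam * equiLag M n k) *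
        ((g (v - equiLag M n (k + 1)) - g (u - equiLag M n (k + 1))) -
          (g (v - equiLag M n k) - g (u - equiLag M n k))) := by
  rw [expRSSum, expRSSum, ← Finset.sum_sub_distrib]
  refine Finset.sum_congr rfl fun k _ => ?_
  ring

/-! ### Strip bounds and their stability under limits -/

section

variable {Ω : Type*} [MeasurableSpace Ω] {μ : Measure Ω} {G : Submodule ℝ (Ω → ℝ)}

/-- For each fixed increment `Y b - Y a` of the process, its covariances with the increments of `Y`
over the intervals of any partition have absolute sum at most `K (b - a) ^ p`. -/
def HasStripBound (μ : Measure Ω) (Y : ℝ → Ω → ℝ) (K p : ℝ) : Prop :=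
  ∀ a b s t : ℝ, 0 ≤ a → a ≤ b → 0 ≤ s → ∀ Q : IntervalPartition s t,
    ∑ j : Fin Q.n, |∫ ω, (Y b ω - Y a ω) * (Y (Q.pt j.succ) ω - Y (Q.pt j.castSucc) ω) ∂μ| ≤
      K * (b - a) ^ p

theorem HasStripBound.const_mul {Y : ℝ → Ω → ℝ} {K p : ℝ} (h : HasStripBound μ Y K p) (c : ℝ) :
    HasStripBound μ (fun t ω => c * Y t ω) (c ^ 2 * K) p := by
  intro a b s t ha hab hs Q
  have e : ∀ x y, ∫ ω, (c * Y b ω - c * Y a ω) * (c * Y y ω - c * Y x ω) ∂μ =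
      c ^ 2 * ∫ ω, (Y b ω - Y a ω) * (Y y ω - Y x ω) ∂μ := fun x y => by
    rw [← integral_const_mul]
    congr 1
    funext ω
    ring
  simp_rw [e, abs_mul, abs_of_nonneg (sq_nonneg c), ← Finset.mul_sum, mul_assoc]
  exact mul_le_mul_of_nonneg_left (h a b s t ha hab hs Q) (sq_nonneg c)

theorem HasStripBound.of_tendsto [IsProbabilityMeasure μ] (hG : IsCenteredGaussianSpace μ G)
    {y : ℕ → ℝ → Ω → ℝ} {Y : ℝ → Ω → ℝ} {K p : ℝ} (hy : ∀ n t, 0 ≤ t → y n t ∈ G)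
    (hlim : ∀ t, 0 ≤ t → ∀ᵐ ω ∂μ, Tendsto (fun n => y n t ω) atTop (𝓝 (Y t ω)))
    (h : ∀ n, HasStripBound μ (y n) K p) : HasStripBound μ Y K p := by
  intro a b s t ha hab hs Q
  have hQ : ∀ i, 0 ≤ Q.pt i := fun i => hs.trans (Q.left_le i)
  have hsub : ∀ u v, 0 ≤ u → 0 ≤ v →
      ∀ᵐ ω ∂μ, Tendsto (fun n => (y n v - y n u) ω) atTop (𝓝 (Y v ω - Y u ω)) := by
    intro u v hu hv
    filter_upwards [hlim u hu, hlim v hv] with ω h1 h2 using h2.sub h1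
  refine le_of_tendsto' (tendsto_finsetSum _ fun j _ => (hG.tendsto_integral_mul
    (fun n => G.sub_mem (hy n b (ha.trans hab)) (hy n a ha))
    (fun n => G.sub_mem (hy n _ (hQ j.succ)) (hy n _ (hQ j.castSucc)))
    (hsub a b ha (ha.trans hab)) (hsub _ _ (hQ j.castSucc) (hQ j.succ))).abs)
    fun n => h n a b s t ha hab hs Q

theorem sum_abs_integral_mul_sum_le (hG : IsCenteredGaussianSpace μ G) {ι : Type*} [Fintype ι]
    {W : ι → Ω → ℝ} (hW : ∀ j, W j ∈ G) {D : ℕ → ι → Ω → ℝ} (hD : ∀ k j, D k j ∈ G) {c : ℕ → ℝ}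
    (hc : Monotone c) (hc0 : 0 ≤ c 0) {n : ℕ} (hc1 : c n ≤ 1) {K : ℝ}
    (hK : ∀ k, ∑ j, |∫ ω, W j ω * D k j ω ∂μ| ≤ K) :
    ∑ j, |∫ ω, W j ω * (∑ k ∈ Finset.range n, c k * (D (k + 1) j ω - D k j ω)) ∂μ| ≤ 2 * K := by
  refine le_trans (le_of_eq ?_) (sum_abs_sum_mul_sub_le hc hc0 hc1 hK)
  refine Finset.sum_congr rfl fun j _ => ?_
  rw [hG.integral_mul_sum (hW j) (Z := fun k ω => D (k + 1) j ω - D k j ω)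
    (fun k => G.sub_mem (hD (k + 1) j) (hD k j)) c n]
  congr 1
  refine Finset.sum_congr rfl fun k _ => ?_
  simp_rw [mul_sub]
  rw [← mul_sub, integral_sub (hG.integrable_mul (hW j) (hD (k + 1) j))
    (hG.integrable_mul (hW j) (hD k j))]

/-- Covariances of a fixed increment of fractional Brownian motion with the increments over the
intervals of a shifted partition. -/
theorem IsFractionalBrownianMotion.sum_abs_integral_le {H : ℝ} {B : ℝ → Ω → ℝ} (hH₀ : 0 < H)
    (hH₁ : H < 1 / 2) (hB : IsFractionalBrownianMotion μ H B) {a b s t : ℝ} (hab : a ≤ b) (h : ℝ)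
    (Q : IntervalPartition s t) :
    ∑ j : Fin Q.n, |∫ ω, (B b ω - B a ω) * (B (Q.pt j.succ - h) ω - B (Q.pt j.castSucc - h) ω) ∂μ|
      ≤ 2 * (b - a) ^ (2 * H) := by
  have hm : ∀ t, MemLp (B t) 2 μ := fun t => (hB.isGaussianProcess.hasGaussianLaw_eval t).memLp_two
  -- Shifting the partition by `-h` amounts to shifting `a` and `b` by `h`, which leaves `b - a`
  -- unchanged.
  have key := Q.sum_abs_rpow_sub_rpow_le (p := 2 * H) (a := a + h) (b := b + h) (by linarith)
    (by linarith) (by linarith) (fun x => rfl)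
  rw [add_sub_add_right_eq_sub] at key
  have e : ∀ x y, |∫ ω, (B b ω - B a ω) * (B (y - h) ω - B (x - h) ω) ∂μ| =
      |(|y - (a + h)| ^ (2 * H) - |y - (b + h)| ^ (2 * H)) -
        (|x - (a + h)| ^ (2 * H) - |x - (b + h)| ^ (2 * H))| / 2 := fun x y => by
    rw [← rectIncrement_covFun μ B _ _ _ _ (hm _) (hm _) (hm _) (hm _)]
    simp only [rectIncrement, covFun, hB.covariance_eq]
    rw [← abs_two, ← abs_div, abs_two]
    simp only [sub_sub, add_comm h]
    congr 1
    ring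
  simp_rw [e, ← Finset.sum_div]
  linarith

theorem IsFractionalBrownianMotion.hasStripBound_expRSSum {H : ℝ} {B : ℝ → Ω → ℝ} (hH₀ : 0 < H)
    (hH₁ : H < 1 / 2) (hB : IsFractionalBrownianMotion μ H B) {lam M : ℝ} (hlam : 0 < lam)
    (hM : 0 < M) (n : ℕ) :
    HasStripBound μ (fun t ω => expRSSum lam (fun s => B s ω) M n t) 8 (2 * H) := by
  intro a b s t _ hab _ Q
  have hG := IsGaussianProcess.isCenteredGaussianSpace_span hB.isGaussianProcess hB.mean_zero
  set G := Submodule.span ℝ (Set.range B)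
  have hBG : ∀ t, B t ∈ G := fun t => Submodule.subset_span ⟨t, rfl⟩
  have hS := expRSSum_mem hBG lam M n
  set c : ℕ → ℝ := fun k => Real.exp (-lam * equiLag M n k) with hc
  have hcm : Monotone c := fun i j hij => by
    have := (equiLag_strictAnti hM n).antitone hij
    refine Real.exp_le_exp.2 ?_
    nlinarith
  have hc0 : 0 ≤ c 0 := (Real.exp_pos _).le
  have hc1 : c (n + 1) ≤ 1 := by simp [hc, equiLag_last]
  -- Summation by parts in the partition argument, against a plain increment of `B` at an arbitrary
  -- lag `h`.
  have h1 : ∀ h : ℝ, ∑ j : Fin Q.n, |∫ ω, (B (b - h) - B (a - h)) ω *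
      (expRSSum lam (fun s => B s ω) M n (Q.pt j.succ) -
        expRSSum lam (fun s => B s ω) M n (Q.pt j.castSucc)) ∂μ| ≤
      2 * (2 * (b - a) ^ (2 * H)) := by
    intro h
    simp_rw [expRSSum_sub]
    have hK := fun k => hB.sum_abs_integral_le hH₀ hH₁ (sub_le_sub_right hab h) (equiLag M n k) Q
    rw [sub_sub_sub_cancel_right] at hK
    exact sum_abs_integral_mul_sum_le hG (W := fun (_ : Fin Q.n) => B (b - h) - B (a - h))
      (D := fun k j => B (Q.pt j.succ - equiLag M n k) - B (Q.pt j.castSucc - equiLag M n k))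
      (fun _ => G.sub_mem (hBG _) (hBG _)) (fun k j => G.sub_mem (hBG _) (hBG _)) hcm hc0 hc1 hK
  -- Summation by parts in the other argument: now `W` depends on `j` and `D` does not, and `h1` at
  -- each lag is the input.
  have h2 := sum_abs_integral_mul_sum_le hG
    (W := fun (j : Fin Q.n) ω => expRSSum lam (fun s => B s ω) M n (Q.pt j.succ) -
        expRSSum lam (fun s => B s ω) M n (Q.pt j.castSucc))
    (D := fun k _ => B (b - equiLag M n k) - B (a - equiLag M n k))
    (fun j => G.sub_mem (hS _) (hS _)) (fun k j => G.sub_mem (hBG _) (hBG _)) hcm hc0 hc1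
    (K := 2 * (2 * (b - a) ^ (2 * H))) (fun k => by
      simp_rw [mul_comm _ ((B (b - equiLag M n k) - B (a - equiLag M n k)) _)]
      exact h1 _)
  simp_rw [expRSSum_sub lam _ M n a b, mul_comm (∑ k ∈ Finset.range (n + 1), _)]
  refine h2.trans (le_of_eq ?_)
  ring

end

/-! ### The Ornstein–Uhlenbeck process -/

/-- The stationary fractional Ornstein–Uhlenbeck process is square integrable, and its strip sums
are controlled by the length of the strip. -/
theorem IsStationaryFOU.memLp_and_hasStripBound {Ω : Type*} [MeasurableSpace Ω] {μ : Measure Ω}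
    [IsProbabilityMeasure μ] {H sigma lam : ℝ} {B X : ℝ → Ω → ℝ} (hH₀ : 0 < H) (hH₁ : H < 1 / 2)
    (hlam : 0 < lam) (hB : IsFractionalBrownianMotion μ H B)
    (hX : IsStationaryFOU μ sigma lam B X) :
    (∀ t, 0 ≤ t → MemLp (X t) 2 μ) ∧ HasStripBound μ X (sigma ^ 2 * 8) (2 * H) := by
  have hG := IsGaussianProcess.isCenteredGaussianSpace_span hB.isGaussianProcess hB.mean_zero
  set G := Submodule.span ℝ (Set.range B)
  have hBG : ∀ t, B t ∈ G := fun t => Submodule.subset_span ⟨t, rfl⟩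
  let y : ℕ → ℕ → ℝ → Ω → ℝ := fun m n t ω => expRSSum lam (fun s => B s ω) (m + 1) n t
  -- The integral over `[t - (m + 1), t]`; `limUnder` defines it at every `ω`, and only almost
  -- surely is it the actual limit.
  let Y : ℕ → ℝ → Ω → ℝ := fun m t ω => limUnder atTop fun n => y m n t ω
  have hM : ∀ m : ℕ, (0 : ℝ) < m + 1 := fun m => by positivity
  have hlim : ∀ t, 0 ≤ t → ∀ᵐ ω ∂μ, (∀ m, Tendsto (fun n => y m n t ω) atTop (𝓝 (Y m t ω))) ∧
      Tendsto (fun m => sigma * Y m t ω) atTop (𝓝 (X t ω)) := by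
    intro t ht
    filter_upwards [hX t ht] with ω ⟨I, ⟨J, hJ, hJI⟩, hXI⟩
    have h1 : ∀ m, Tendsto (fun n => y m n t ω) atTop (𝓝 (J (t - (m + 1)))) := fun m =>
      (hJ _ (by linarith [hM m])).tendsto_expRSSum (hM m)
    have h2 : ∀ m, Y m t ω = J (t - (m + 1)) := fun m => (h1 m).limUnder_eq
    refine ⟨fun m => by rw [h2]; exact h1 m, ?_⟩
    simp_rw [h2, hXI]
    refine (hJI.comp ?_).const_mul sigma
    exact tendsto_atBot_add_const_left _ t
      (tendsto_neg_atTop_atBot.comp (tendsto_atTop_add_const_right _ 1 tendsto_natCast_atTop_atTop))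
  have hYG : ∀ m t, 0 ≤ t → Y m t ∈ aeLimits μ G := fun m t ht =>
    ⟨fun n => y m n t, fun n => expRSSum_mem hBG _ _ _ _, by
      filter_upwards [hlim t ht] with ω h using h.1 m⟩
  have hsYG : ∀ m t, 0 ≤ t → (fun ω => sigma * Y m t ω) ∈ aeLimits μ G := fun m t ht =>
    (aeLimits μ G).smul_mem sigma (hYG m t ht)
  have hXl : ∀ t, 0 ≤ t → ∀ᵐ ω ∂μ, Tendsto (fun m => sigma * Y m t ω) atTop (𝓝 (X t ω)) :=
    fun t ht => (hlim t ht).mono fun ω h => h.2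
  constructor
  -- Two almost sure limits are taken, mesh to 0 and then cut-off to `-∞`, hence `aeLimits` twice.
  · exact fun t ht => hG.aeLimits.aeLimits.memLp_two ⟨_, fun m => hsYG m t ht, hXl t ht⟩
  · refine HasStripBound.of_tendsto hG.aeLimits hsYG hXl fun m => HasStripBound.const_mul ?_ sigma
    exact HasStripBound.of_tendsto hG (fun n t _ => expRSSum_mem hBG lam (m + 1) n t)
      (fun t ht => (hlim t ht).mono fun ω h => h.1 m)
      fun n => hB.hasStripBound_expRSSum hH₀ hH₁ hlam (hM m) n

theorem mainTheorem9 (H : ℝ) (hH₀ : 0 < H) (hH₁ : H < 1 / 2) (sigma lam : ℝ) (hlam : 0 < lam) :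
    ∃ C : ℝ, 0 < C ∧
      ∀ (Ω : Type*) [MeasurableSpace Ω] (μ : Measure Ω) [IsProbabilityMeasure μ]
        (B X : ℝ → Ω → ℝ), IsFractionalBrownianMotion μ H B → IsStationaryFOU μ sigma lam B X →
        (∀ t : ℝ, 0 ≤ t → MemLp (X t) 2 μ) ∧
        ∀ T : ℝ, 0 < T →
          pVariation2D (1 / (2 * H)) (covFun μ X) 0 T 0 T < ∞ ∧
          ∀ s t : ℝ, 0 ≤ s → s < t → t ≤ T →
            pVariation2D (1 / (2 * H)) (covFun μ X) s t s t ^ (1 / (2 * H)) ≤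
              ENNReal.ofReal (C * (t - s)) := by
  have hρ : 1 ≤ 1 / (2 * H) := by
    rw [le_div_iff₀ (by linarith)]
    linarith
  have hρ0 : 0 < 1 / (2 * H) := by linarith
  have hK : 0 ≤ sigma ^ 2 * 8 := by positivity
  -- The summand 1 keeps the constant positive when `sigma = 0`.
  refine ⟨(sigma ^ 2 * 8) ^ (1 / (2 * H)) + 1, by positivity, fun Ω _ μ _ B X hB hX => ?_⟩
  obtain ⟨hm, hstrip⟩ := hX.memLp_and_hasStripBound hH₀ hH₁ hlam hB
  have hsup := fun s t (hs : 0 ≤ s) =>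
    iSup_sum_rpow_rectIncrement_le (R := covFun μ X) (s := s) (t := t) hρ hK
      fun a b ha hab Q => by
        have ha0 := hs.trans ha
        have hQ : ∀ i, 0 ≤ Q.pt i := fun i => hs.trans (Q.left_le i)
        simp_rw [fun i : Fin Q.n => rectIncrement_covFun μ X a b (Q.pt i.castSucc) (Q.pt i.succ)
          (hm _ ha0) (hm _ (ha0.trans hab)) (hm _ (hQ _)) (hm _ (hQ _)), one_div_one_div]
        exact hstrip a b s t ha0 hab hs Q
  refine ⟨hm, fun T _ => ⟨?_, fun s t hs hst _ => ?_⟩⟩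
  · exact ENNReal.rpow_lt_top_of_nonneg (by positivity)
      ((hsup 0 T le_rfl).trans_lt ENNReal.ofReal_lt_top).ne
  · rw [pVariation2D, ← ENNReal.rpow_mul, one_div_mul_cancel hρ0.ne', ENNReal.rpow_one]
    refine (hsup s t hs).trans (ENNReal.ofReal_le_ofReal ?_)
    have : 0 ≤ t - s := by linarith
    gcongr
    linarith
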